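/- A set $S$ of integers is called a $B^*[g]$ set if for every integer $m$ there are at most $g$ ordered pairs $(s_1,s_2)\in S\times S$ with $s_1+s_2=m$. For positive integers $g,n$ let $R(g,n)$ be the largest size of a $B^*[g]$ set contained in $\{1,2,\dots,n\}$, and let $$\overline{\rho}(g)=\limsup_{n\to\infty}\frac{R(g,n)}{\sqrt{gn}}.$$ **Theorem.** For all positive integers $g$ and $n$, $$R(g,n)\le 1.30036\,\sqrt{gn},$$ and if $g\ge 3$ is odd, then for all positive integers $n$ $$R(g,n)\le 1.31925\,\sqrt{(g-1)n}+\tfrac13 .$$ Moreover, for every integer $g\ge2$, $$\overline{\rho}(g)^2\le \begin{cases} 1.74043-\dfrac{1.00483}{g}, & g\le 8 \text{ and } g \text{ even};\\[2mm] 1.58337-\dfrac{0.026335}{g}+\sqrt{0.011572-\dfrac{0.083397}{g}+\dfrac{0.00069356}{g^2}}, & g\ge 10 \text{ and } g \text{ even};\\[2mm] 1.74043-\dfrac{2.74525}{g}, & g\le 23 \text{ and } g \text{ odd};\\[2mm] 1.58337-\dfrac{0.071949}{g}+\sqrt{0.011572-\dfrac{0.22784}{g}+\dfrac{0.0051768}{g^2}},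 & g\ge 25 \text{ and } g \text{ odd}. \end{cases}$$ -/

import Mathlib

namespace BStar

/-- A set `S` of integers is a `B*[g]` set if every integer `m` is a sum `s₁ + s₂` for at most `g`
ordered pairs `(s₁, s₂)` in `S × S`. -/
def IsBStar (g : ℕ) (S : Set ℤ) : Prop :=
  ∀ m : ℤ, {p : ℤ × ℤ | p.1 ∈ S ∧ p.2 ∈ S ∧ p.1 + p.2 = m}.encard ≤ (g : ℕ∞)

open Classical in
/-- `R g n` is the largest size of a `B*[g]` set contained in `{1, …, n}`. (The family over which
the maximum is taken is finite and contains the empty set.) -/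
noncomputable def R (g n : ℕ) : ℕ :=
  ((Finset.Icc (1 : ℤ) (n : ℤ)).powerset.filter
    fun S : Finset ℤ => IsBStar g (S : Set ℤ)).sup Finset.card

/-- The upper limit of `R g n / √(g n)` as `n → ∞`. (The quotients lie between `0` and `√2`, so
this is a genuine real upper limit.) -/
noncomputable def rhoBar (g : ℕ) : ℝ :=
  Filter.limsup (fun n : ℕ => (R g n : ℝ) / √((g : ℝ) * (n : ℝ))) Filter.atTop

end BStar

/-!
Write `r k` for the number of ordered pairs of elements of `S` with difference `k`. For any test
function `f`, expanding `∑ (r k - f k) ^ 2` and keeping only its term `k = 0`, where `r 0 = #S`,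
bounds `2 ∑ r k * f k + (#S - f 0) ^ 2` by `∑ r k ^ 2 + ∑ f k ^ 2`. Here `∑ r k ^ 2` is the additive
energy of `S`, which a `B*[g]` set keeps below `g * #S ^ 2`. For odd `g` it is even below
`(g - 1) * #S ^ 2 + g * #S`, because `s₁ + s₂ = m` has an odd number of solutions only if `m` is
twice an element of `S`.

The test function is a constant plus a multiple of the triangle `k ↦ max (L - |k|) 0` with `L`
about `n / 5`. The triangle-weighted number of differences is bounded below by Cauchy–Schwarz for
the number of elements, in windows of length `L`, of `S` together with its reflection `n + 1 - S`:
the mixed terms are triangle-weighted sums of two elements of `S`, hence at most `g * L ^ 2`.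
-/

namespace BStar

open Finset Filter Topology
open scoped Combinatorics.Additive Pointwise

/-! ### Convolutions and additive energy -/

section AddCommGroup

variable {G : Type*} [AddCommGroup G] [DecidableEq G] {A B S T : Finset G}

lemma sum_addConvolution_mul {R : Type*} [NonAssocSemiring R] (hT : A + B ⊆ T) (φ : G → R) :
    ∑ m ∈ T, (A.addConvolution B m : R) * φ m = ∑ a ∈ A, ∑ b ∈ B, φ (a + b) := by
  have hmaps : ∀ x ∈ A ×ˢ B, x.1 + x.2 ∈ T := fun x hx =>
    hT (add_mem_add (mem_product.1 hx).1 (mem_product.1 hx).2)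
  rw [← sum_product' A B fun a b => φ (a + b), ← sum_fiberwise_of_maps_to hmaps]
  refine sum_congr rfl fun m _ => ?_
  rw [sum_congr rfl fun x hx => congrArg φ (mem_filter.1 hx).2, sum_const, nsmul_eq_mul,
    card_add_eq]

lemma sum_addConvolution (hT : A + B ⊆ T) : ∑ m ∈ T, A.addConvolution B m = #A * #B := by
  simpa using sum_addConvolution_mul hT fun _ => (1 : ℕ)

lemma sum_addConvolution_neg_mul {R : Type*} [NonAssocSemiring R] (hT : A - B ⊆ T) (φ : G → R) :
    ∑ k ∈ T, (A.addConvolution (-B) k : R) * φ k = ∑ a ∈ A, ∑ b ∈ B, φ (a - b) := by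
  rw [sum_addConvolution_mul (by rwa [← sub_eq_add_neg])]
  simp only [sum_neg_index, sub_eq_add_neg]

lemma sum_addConvolution_sq (hT : A + B ⊆ T) : ∑ m ∈ T, A.addConvolution B m ^ 2 = E[A, B] := by
  rw [addEnergy_eq_sum_sq']
  refine (sum_subset hT fun m _ hm => ?_).symm
  rw [addConvolution_eq_zero.2 hm, zero_pow two_ne_zero]

lemma addEnergy_neg_right (A B : Finset G) : E[A, -B] = E[A, B] := by
  refine card_equiv ((Equiv.refl _).prodCongr
    ((Equiv.prodComm _ _).trans ((Equiv.neg _).prodCongr (Equiv.neg _)))) ?_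
  rintro ⟨⟨a₁, a₂⟩, b₁, b₂⟩
  simp only [mem_filter, mem_product, mem_neg', Equiv.prodCongr_apply, Prod.map, Equiv.refl_apply,
    Equiv.trans_apply, Equiv.prodComm_apply, Prod.swap_prod_mk, Equiv.neg_apply,
    ← sub_eq_add_neg, sub_eq_sub_iff_add_eq_add]
  rw [and_comm (a := -b₁ ∈ B)]

lemma addConvolution_neg_self_zero (A : Finset G) : A.addConvolution (-A) 0 = #A := by
  rw [← card_inter_vadd, zero_vadd, inter_self]

lemma even_addConvolution_self {m : G} (h : ∀ a ∈ A, a + a ≠ m) :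
    Even (A.addConvolution A m) := by
  rw [← ZMod.natCast_eq_zero_iff_even, ← card_add_eq, cast_card]
  refine sum_involution (fun x _ => x.swap) (fun _ _ => by decide) ?_ ?_ fun _ _ => Prod.swap_swap _
  · rintro ⟨a, b⟩ hx _ hfix
    simp only [mem_filter, mem_product, Prod.swap_prod_mk, Prod.mk.injEq] at hx hfix
    exact h a hx.1.1 (by rw [← hx.2, hfix.1])
  · rintro ⟨a, b⟩ hx
    simp only [mem_filter, mem_product, Prod.swap_prod_mk] at hx ⊢
    exact ⟨hx.1.symm, add_comm b a ▸ hx.2⟩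

lemma sq_sub_add_two_mul_sum_le_addEnergy (hT : S - S ⊆ T) (h0 : 0 ∈ T) (f : G → ℝ) :
    (#S - f 0) ^ 2 + 2 * ∑ p ∈ S, ∑ q ∈ S, f (p - q) ≤ E[S] + ∑ k ∈ T, f k ^ 2 := by
  have hzero : (#S - f 0) ^ 2 ≤ ∑ k ∈ T, (S.addConvolution (-S) k - f k) ^ 2 := by
    simpa only [addConvolution_neg_self_zero] using
      single_le_sum (f := fun k => ((S.addConvolution (-S) k : ℝ) - f k) ^ 2)
        (fun k _ => sq_nonneg _) h0
  have henergy : ∑ k ∈ T, (S.addConvolution (-S) k : ℝ) ^ 2 = E[S] := by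
    rw [sub_eq_add_neg] at hT
    exact_mod_cast (sum_addConvolution_sq hT).trans (addEnergy_neg_right S S)
  simp only [sub_sq, sum_add_distrib, sum_sub_distrib, mul_assoc, ← mul_sum,
    sum_addConvolution_neg_mul hT, henergy] at hzero
  linarith

end AddCommGroup

/-! ### The triangular kernel and window counts -/

/-- The triangular (Fejér-type) kernel `k ↦ max (L - |k|) 0`, written with truncated subtraction. -/
def triangle (L : ℕ) (k : ℤ) : ℕ := L - k.natAbs

lemma triangle_zero_right (L : ℕ) : triangle L 0 = L := rfl

lemma triangle_succ (L : ℕ) (k : ℤ) :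
    triangle (L + 1) k = triangle L k + if k ∈ Icc (-L : ℤ) L then 1 else 0 := by
  simp only [triangle, mem_Icc]
  split_ifs <;> omega

lemma sum_indicator_Icc {L n : ℕ} (hL : L < n) :
    ∑ k ∈ Ioo (-n : ℤ) n, (if k ∈ Icc (-L : ℤ) L then 1 else 0) = 2 * L + 1 := by
  have hsub : Icc (-L : ℤ) L ⊆ Ioo (-n : ℤ) n := fun k => by simp only [mem_Icc, mem_Ioo]; omega
  rw [sum_ite_mem, inter_eq_right.2 hsub, sum_const, Int.card_Icc, smul_eq_mul]
  omega

lemma sum_triangle {L n : ℕ} (hL : L ≤ n) : ∑ k ∈ Ioo (-n : ℤ) n, triangle L k = L ^ 2 := by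
  induction L with
  | zero => simp [triangle]
  | succ L ih =>
    simp only [triangle_succ, sum_add_distrib, ih (by omega), sum_indicator_Icc hL]
    ring

lemma three_mul_sum_triangle_sq {L n : ℕ} (hL : L ≤ n) :
    3 * ∑ k ∈ Ioo (-n : ℤ) n, triangle L k ^ 2 = L * (2 * L ^ 2 + 1) := by
  induction L with
  | zero => simp [triangle]
  | succ L ih =>
    have hstep (k : ℤ) : triangle (L + 1) k ^ 2 = triangle L k ^ 2 + 2 * triangle L k
        + if k ∈ Icc (-L : ℤ) L then 1 else 0 := by
      rw [triangle_succ]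
      split_ifs with hk
      · ring
      · have : triangle L k = 0 := by simp only [triangle, mem_Icc] at hk ⊢; omega
        simp [this]
    simp only [hstep, sum_add_distrib, ← mul_sum, sum_triangle (Nat.le_of_succ_le hL),
      sum_indicator_Icc hL]
    linarith [ih (Nat.le_of_succ_le hL)]

/-- The number of elements of `S` in the window `{x, …, x + L - 1}`. -/
def windowCount (S : Finset ℤ) (L : ℕ) (x : ℤ) : ℕ := #{s ∈ S | x ≤ s ∧ s < x + L}

lemma card_filter_mem_windows {a b p : ℤ} (hp : p ∈ Icc a b) (q : ℤ) (L : ℕ) :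
    #{x ∈ Ioc (a - L) b | (x ≤ p ∧ p < x + L) ∧ x ≤ q ∧ q < x + L} = triangle L (p - q) := by
  have : {x ∈ Ioc (a - L) b | (x ≤ p ∧ p < x + L) ∧ x ≤ q ∧ q < x + L}
      = Ioc (max p q - L) (min p q) := by
    ext x
    simp only [mem_filter, mem_Icc, mem_Ioc] at hp ⊢
    omega
  rw [this, Int.card_Ioc, triangle]
  omega

lemma sum_windowCount_mul_windowCount {A : Finset ℤ} {a b : ℤ} (hA : A ⊆ Icc a b) (B : Finset ℤ)
    (L : ℕ) :
    ∑ x ∈ Ioc (a - L) b, windowCount A L x * windowCount B L x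
      = ∑ p ∈ A, ∑ q ∈ B, triangle L (p - q) := by
  simp only [windowCount, card_filter, sum_mul_sum]
  rw [sum_comm]
  refine sum_congr rfl fun p hp => ?_
  rw [sum_comm]
  refine sum_congr rfl fun q _ => ?_
  rw [← card_filter_mem_windows (hA hp), card_filter]
  simp only [ite_and, ite_mul, one_mul, zero_mul]

lemma sum_windowCount {A : Finset ℤ} {a b : ℤ} (hA : A ⊆ Icc a b) (L : ℕ) :
    ∑ x ∈ Ioc (a - L) b, windowCount A L x = #A * L := by
  simp only [windowCount, card_filter]
  rw [sum_comm]
  refine sum_const_nat fun p hp => ?_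
  simpa only [card_filter, and_self, sub_self, triangle_zero_right] using
    card_filter_mem_windows (hA hp) p L

lemma sum_vadd_neg {M : Type*} [AddCommMonoid M] (S : Finset ℤ) (c : ℤ) (φ : ℤ → M) :
    ∑ t ∈ c +ᵥ -S, φ t = ∑ s ∈ S, φ (c - s) := by
  rw [vadd_finset_def, sum_image (AddAction.injective c).injOn, sum_neg_index]
  simp only [vadd_eq_add, sub_eq_add_neg]

lemma vadd_neg_subset_Icc {S : Finset ℤ} {n : ℕ} (hS : S ⊆ Icc (1 : ℤ) n) :
    ((n : ℤ) + 1) +ᵥ -S ⊆ Icc (1 : ℤ) n := by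
  intro t ht
  obtain ⟨s, hs, rfl⟩ := mem_vadd_finset.1 ht
  have := mem_Icc.1 (hS (mem_neg'.1 hs))
  rw [vadd_eq_add, mem_Icc]
  omega

lemma two_mul_sq_le_mul_sum_triangle {S : Finset ℤ} {L n : ℕ} (hS : S ⊆ Icc (1 : ℤ) n)
    (hL : 1 ≤ L) :
    2 * (#S * L) ^ 2 ≤ (n + L - 1) *
      (∑ p ∈ S, ∑ q ∈ S, triangle L (p - q) + ∑ p ∈ S, ∑ q ∈ S, triangle L (p + q - (n + 1))) := by
  set T : Finset ℤ := ((n : ℤ) + 1) +ᵥ -S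
  have hT : T ⊆ Icc (1 : ℤ) n := vadd_neg_subset_Icc hS
  have hcardT : #T = #S := by rw [card_vadd_finset, card_neg]
  have hcard : #(Ioc (1 - (L : ℤ)) n) = n + L - 1 := by rw [Int.card_Ioc]; omega
  have hcauchy := sq_sum_le_card_mul_sum_sq (s := Ioc (1 - (L : ℤ)) n)
    (f := fun x => windowCount S L x + windowCount T L x)
  have hmixed : ∑ p ∈ S, ∑ q ∈ T, triangle L (p - q)
      = ∑ p ∈ S, ∑ q ∈ S, triangle L (p + q - (n + 1)) := by
    simp only [T, sum_vadd_neg, sub_sub_eq_add_sub]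
  have hreflected : ∑ p ∈ T, ∑ q ∈ T, triangle L (p - q)
      = ∑ p ∈ S, ∑ q ∈ S, triangle L (p - q) := by
    simp only [T, sum_vadd_neg, sub_sub_sub_cancel_left]
    exact sum_comm
  simp only [add_sq, mul_assoc, sum_add_distrib, ← mul_sum, sq (windowCount _ _ _),
    sum_windowCount_mul_windowCount hS, sum_windowCount_mul_windowCount hT, sum_windowCount hS,
    sum_windowCount hT, hmixed, hreflected, hcard, hcardT] at hcauchy
  linarith

lemma card_le_of_subset_Icc {S : Finset ℤ} {n : ℕ} (hS : S ⊆ Icc (1 : ℤ) n) : #S ≤ n := by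
  simpa using card_le_card hS

lemma sub_subset_Ioo {S : Finset ℤ} {n : ℕ} (hS : S ⊆ Icc (1 : ℤ) n) : S - S ⊆ Ioo (-n : ℤ) n := by
  intro k hk
  obtain ⟨p, hp, q, hq, rfl⟩ := mem_sub.1 hk
  have hp := mem_Icc.1 (hS hp)
  have hq := mem_Icc.1 (hS hq)
  rw [mem_Ioo]
  omega

lemma cast_card_Ioo_neg {n : ℕ} (hn : 1 ≤ n) : (#(Ioo (-n : ℤ) n) : ℝ) = 2 * n - 1 := by
  rw [Int.card_Ioo, show ((n : ℤ) - -n - 1).toNat = 2 * n - 1 by omega, Nat.cast_sub (by omega)]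
  push_cast
  ring

lemma sq_sub_add_le_addEnergy_of_const {S : Finset ℤ} {n : ℕ} (hS : S ⊆ Icc (1 : ℤ) n)
    (hn : 1 ≤ n) (a : ℝ) :
    (#S - a) ^ 2 + 2 * a * #S ^ 2 ≤ E[S] + a ^ 2 * (2 * n - 1) := by
  have h := sq_sub_add_two_mul_sum_le_addEnergy (sub_subset_Ioo hS) (mem_Ioo.2 (by omega))
    fun _ => a
  simp only [sum_const, nsmul_eq_mul, cast_card_Ioo_neg hn] at h
  linarith

/-! ### Representation counts of `B*[g]` sets -/

namespace IsBStar

variable {g : ℕ} {S : Finset ℤ}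

lemma addConvolution_le (hB : IsBStar g (S : Set ℤ)) (m : ℤ) : S.addConvolution S m ≤ g := by
  have hset : {p : ℤ × ℤ | p.1 ∈ (S : Set ℤ) ∧ p.2 ∈ (S : Set ℤ) ∧ p.1 + p.2 = m}
      = ({p ∈ S ×ˢ S | p.1 + p.2 = m} : Finset (ℤ × ℤ)) := by
    ext; simp [and_assoc]
  have hm := hB m
  rw [hset, Set.encard_coe_eq_coe_finsetCard, card_add_eq] at hm
  exact_mod_cast hm

lemma addEnergy_le (hB : IsBStar g (S : Set ℤ)) : E[S] ≤ g * #S ^ 2 := by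
  calc E[S] = ∑ m ∈ S + S, S.addConvolution S m ^ 2 := (sum_addConvolution_sq subset_rfl).symm
    _ ≤ ∑ m ∈ S + S, g * S.addConvolution S m := by
      gcongr with m
      rw [sq]
      exact Nat.mul_le_mul_right _ (hB.addConvolution_le m)
    _ = g * #S ^ 2 := by rw [← mul_sum, sum_addConvolution subset_rfl, sq]

lemma addConvolution_lt_of_odd (hB : IsBStar g (S : Set ℤ)) (hg : Odd g) {m : ℤ}
    (hm : ∀ s ∈ S, s + s ≠ m) : S.addConvolution S m < g :=
  (hB.addConvolution_le m).lt_of_ne fun h =>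
    Nat.not_even_iff_odd.2 hg (h ▸ even_addConvolution_self hm)

lemma addEnergy_add_sq_le_of_odd (hB : IsBStar g (S : Set ℤ)) (hg : Odd g) :
    E[S] + #S ^ 2 ≤ g * (#S ^ 2 + #S) := by
  have hpoint (m : ℤ) : S.addConvolution S m ^ 2 + S.addConvolution S m
      ≤ g * (S.addConvolution S m + if m ∈ S.image (fun s => s + s) then 1 else 0) := by
    split_ifs with hm
    · nlinarith [hB.addConvolution_le m]
    · have hlt := hB.addConvolution_lt_of_odd hg fun s hs h => hm (mem_image.2 ⟨s, hs, h⟩)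
      nlinarith
  have hdouble : #((S + S) ∩ S.image fun s => s + s) ≤ #S :=
    (card_le_card inter_subset_right).trans card_image_le
  calc E[S] + #S ^ 2
      = ∑ m ∈ S + S, (S.addConvolution S m ^ 2 + S.addConvolution S m) := by
        rw [sum_add_distrib, sum_addConvolution_sq subset_rfl, sum_addConvolution subset_rfl, sq]
    _ ≤ ∑ m ∈ S + S,
          g * (S.addConvolution S m + if m ∈ S.image (fun s => s + s) then 1 else 0) :=
        sum_le_sum fun m _ => hpoint m
    _ = g * (#S ^ 2 + #((S + S) ∩ S.image fun s => s + s)) := by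
        rw [← mul_sum, sum_add_distrib, sum_addConvolution subset_rfl, sum_ite_mem, sum_const,
          smul_eq_mul, mul_one, sq]
    _ ≤ g * (#S ^ 2 + #S) := by gcongr

lemma sum_triangle_le (hB : IsBStar g (S : Set ℤ)) {L n : ℕ} (hS : S ⊆ Icc (1 : ℤ) n)
    (hL : L ≤ n) : ∑ p ∈ S, ∑ q ∈ S, triangle L (p + q - (n + 1)) ≤ g * L ^ 2 := by
  have hT : S + S ⊆ ((n : ℤ) + 1) +ᵥ Ioo (-n : ℤ) n := by
    intro m hm
    obtain ⟨p, hp, q, hq, rfl⟩ := mem_add.1 hm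
    have hp := mem_Icc.1 (hS hp)
    have hq := mem_Icc.1 (hS hq)
    exact mem_vadd_finset.2
      ⟨p + q - (n + 1), mem_Ioo.2 (by omega), add_sub_cancel _ _⟩
  rw [← sum_addConvolution_mul hT fun m => triangle L (m - (n + 1)), vadd_finset_def,
    sum_image (AddAction.injective _).injOn, ← sum_triangle hL, mul_sum]
  simp only [vadd_eq_add, add_sub_cancel_left, Nat.cast_id]
  gcongr
  exact hB.addConvolution_le _

lemma card_div_sub_le_sum_triangle (hB : IsBStar g (S : Set ℤ)) {L n : ℕ}
    (hS : S ⊆ Icc (1 : ℤ) n) (hL₀ : 1 ≤ L) (hL : L ≤ n) :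
    2 * (#S * L : ℝ) ^ 2 / (n + L - 1) - g * L ^ 2
      ≤ ∑ p ∈ S, ∑ q ∈ S, (triangle L (p - q) : ℝ) := by
  have hmixed : ∑ p ∈ S, ∑ q ∈ S, (triangle L (p + q - (n + 1)) : ℝ) ≤ g * L ^ 2 := by
    exact_mod_cast hB.sum_triangle_le hS hL
  have hcast : ((n + L - 1 : ℕ) : ℝ) = n + L - 1 := by
    rw [Nat.cast_pred (by omega), Nat.cast_add]
  have hpos : (0 : ℝ) < n + L - 1 := by
    rw [← hcast]
    exact_mod_cast (by omega : 0 < n + L - 1)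
  have hcauchy := Nat.cast_le (α := ℝ).2 (two_mul_sq_le_mul_sum_triangle hS hL₀)
  push_cast [hcast] at hcauchy
  linarith [(div_le_iff₀' hpos).2 hcauchy]

lemma two_mul_card_le (hB : IsBStar g (S : Set ℤ)) {n : ℕ} (hS : S ⊆ Icc (1 : ℤ) n) :
    2 * #S ≤ n + g := by
  set T : Finset ℤ := ((n : ℤ) + 1) +ᵥ -S
  have hunion : #(S ∪ T) ≤ n := by
    simpa using card_le_card (union_subset hS (vadd_neg_subset_Icc hS))
  have hinter : #(S ∩ T) ≤ g := by
    rw [card_inter_vadd, neg_neg]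
    exact hB.addConvolution_le _
  have hcardT : #T = #S := by rw [card_vadd_finset, card_neg]
  have := card_union_add_card_inter S T
  omega

lemma sq_sub_add_le_addEnergy (hB : IsBStar g (S : Set ℤ)) {L n : ℕ} (hS : S ⊆ Icc (1 : ℤ) n)
    (hL₀ : 1 ≤ L) (hL : L ≤ n) (a : ℝ) {b : ℝ} (hb : 0 ≤ b) :
    (#S - (a + b * L)) ^ 2 + 2 * a * #S ^ 2
        + 2 * b * (2 * (#S * L) ^ 2 / (n + L - 1) - g * L ^ 2)
      ≤ E[S] + a ^ 2 * (2 * n - 1) + 2 * a * b * L ^ 2 + b ^ 2 * (L * (2 * L ^ 2 + 1) / 3) := by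
  have hmass : ∑ k ∈ Ioo (-n : ℤ) n, (triangle L k : ℝ) = L ^ 2 := by
    exact_mod_cast sum_triangle hL
  have hmass₂ : ∑ k ∈ Ioo (-n : ℤ) n, (triangle L k : ℝ) ^ 2 = L * (2 * L ^ 2 + 1) / 3 := by
    rw [eq_div_iff three_ne_zero, mul_comm]
    exact_mod_cast three_mul_sum_triangle_sq hL
  have htest : ∑ k ∈ Ioo (-n : ℤ) n, (a + b * triangle L k) ^ 2
      = a ^ 2 * (2 * n - 1) + 2 * a * b * L ^ 2 + b ^ 2 * (L * (2 * L ^ 2 + 1) / 3) := by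
    simp only [add_sq, mul_pow, ← mul_assoc, sum_add_distrib, ← mul_sum, hmass, hmass₂, sum_const,
      nsmul_eq_mul, cast_card_Ioo_neg (hL₀.trans hL)]
    ring
  have henergy := sq_sub_add_two_mul_sum_le_addEnergy (sub_subset_Ioo hS) (mem_Ioo.2 (by omega))
    fun k => a + b * triangle L k
  simp only [triangle_zero_right, htest, sum_add_distrib, ← mul_sum, sum_const,
    nsmul_eq_mul] at henergy
  linarith [mul_le_mul_of_nonneg_left (hB.card_div_sub_le_sum_triangle hS hL₀ hL) hb]

end IsBStar

/-! ### Finite bounds -/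

-- The right-hand side is the net coefficient of `#S ^ 4` in `IsBStar.sq_sub_add_le_addEnergy` for
-- `n = x`, `L = l`, `a = 2 * #S ^ 2 / (5 * n)` and `b = #S ^ 2 / (5 * L ^ 2)`.
lemma div_le_kernel_gain {x l : ℝ} (hl : 3 ≤ l) (hx : x ≤ 5 * l) (hl' : 5 * l ≤ x + 4) :
    64 / 75 / x ≤ 4 / 5 / x + 4 / 5 / (x + l - 1) - 4 / 25 * (2 * x - 1) / x ^ 2 - 4 / 25 / x
      - (2 * l ^ 2 + 1) / (75 * l ^ 3) := by
  have hx₀ : 0 < x := by linarith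
  have hl₀ : 0 < l := by linarith
  have hwindows : 2 / 3 / x ≤ 4 / 5 / (x + l - 1) := by
    rw [div_le_div_iff₀ hx₀ (by linarith)]
    linarith
  have hleading : 2 / 75 / l ≤ 2 / 15 / x := by
    rw [div_le_div_iff₀ hl₀ hx₀]
    linarith
  have hlower : 1 / 75 / l ^ 3 ≤ 4 / 25 / x ^ 2 := by
    rw [div_le_div_iff₀ (by positivity) (by positivity)]
    nlinarith [pow_le_pow_left₀ hx₀.le hx 2, pow_pos hl₀ 2]
  have hsq : 4 / 25 * (2 * x - 1) / x ^ 2 = 8 / 25 / x - 4 / 25 / x ^ 2 := by field_simp; ring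
  have hcube : (2 * l ^ 2 + 1) / (75 * l ^ 3) = 2 / 75 / l + 1 / 75 / l ^ 3 := by field_simp
  rw [hsq, hcube]
  linarith [show 64 / 75 / x = 4 / 5 / x + 2 / 3 / x - 8 / 25 / x - 4 / 25 / x - 2 / 15 / x by ring]

-- Contradicts `IsBStar.sq_sub_add_le_addEnergy` with `L = 6`, `a = 3`, `b = 4 / 5` for a `B*[5]`
-- set of size `t` when `n = (t - 1 / 3) ^ 2 / 6.9616`.
lemma mul_sq_le_add_div {t : ℝ} (ht : 12 ≤ t) :
    18 * ((t - 1 / 3) ^ 2 / 6.9616) ≤ 3 * t ^ 2 - 103 / 5 * t - 2422 / 5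
      + 576 / 5 * t ^ 2 / ((t - 1 / 3) ^ 2 / 6.9616 + 5) := by
  obtain ⟨v, rfl⟩ : ∃ v, t = v + 12 := ⟨t - 12, by ring⟩
  have hv : 0 ≤ v := by linarith
  rw [← sub_le_iff_le_add', le_div_iff₀ (by positivity), ← sub_nonneg]
  ring_nf
  positivity

lemma mul_sub_third_sq_le {s t : ℝ} (hs : 7 ≤ s) (ht : 11 ≤ t) :
    ((7 / 5 * s - 1) * t + s) * (t - 1 / 3) ^ 2 ≤ 1.7404 * (s - 1) * (64 / 75 * t ^ 3) := by
  obtain ⟨u, rfl⟩ : ∃ u, s = u + 7 := ⟨s - 7, by ring⟩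
  obtain ⟨v, rfl⟩ : ∃ v, t = v + 11 := ⟨t - 11, by ring⟩
  have hu : 0 ≤ u := by linarith
  have hv : 0 ≤ v := by linarith
  rw [← sub_nonneg]
  ring_nf
  positivity

namespace IsBStar

variable {g : ℕ} {S : Finset ℤ}

lemma sq_sub_add_pow_four_le (hB : IsBStar g (S : Set ℤ)) {L n : ℕ} (hS : S ⊆ Icc (1 : ℤ) n)
    (hL : 3 ≤ L) (hn : n ≤ 5 * L) (hLn : 5 * L ≤ n + 4) :
    ((#S : ℝ) - (2 / 5 * #S ^ 2 / n + #S ^ 2 / (5 * L))) ^ 2 + 64 / 75 / n * #S ^ 4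
      ≤ E[S] + 2 / 5 * g * #S ^ 2 := by
  have hn₀ : (0 : ℝ) < n := by exact_mod_cast (by omega : 0 < n)
  have : (0 : ℝ) < L := by exact_mod_cast (by omega : 0 < L)
  have hgain := div_le_kernel_gain (x := n) (l := L) (by exact_mod_cast hL) (by exact_mod_cast hn)
    (by exact_mod_cast hLn)
  have htest := hB.sq_sub_add_le_addEnergy hS (by omega : 1 ≤ L) (by omega : L ≤ n)
    (2 / 5 * #S ^ 2 / n) (b := #S ^ 2 / (5 * L ^ 2)) (by positivity)
  have hpoint : (#S : ℝ) ^ 2 / (5 * L ^ 2) * L = #S ^ 2 / (5 * L) := by field_simp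
  have hd : (0 : ℝ) < n + L - 1 := by
    linarith [show (1 : ℝ) ≤ L by exact_mod_cast (by omega : 1 ≤ L)]
  rw [hpoint] at htest
  have hrest := mul_le_mul_of_nonneg_right hgain (by positivity : (0 : ℝ) ≤ #S ^ 4)
  refine sub_nonneg.1 ?_
  refine (sub_nonneg.2 (add_le_add htest hrest)).trans_eq ?_
  field_simp
  ring

lemma card_pow_four_le (hB : IsBStar g (S : Set ℤ)) {n : ℕ} (hS : S ⊆ Icc (1 : ℤ) n)
    (hn : 11 ≤ n) : 64 / 75 * (#S : ℝ) ^ 4 ≤ (E[S] + 2 / 5 * g * #S ^ 2) * n := by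
  have h := hB.sq_sub_add_pow_four_le hS (L := (n + 4) / 5) (by omega) (by omega) (by omega)
  have hn₀ : (0 : ℝ) < n := by exact_mod_cast (by omega : 0 < n)
  rw [← div_le_iff₀ hn₀, mul_div_right_comm]
  exact (le_add_of_nonneg_left (sq_nonneg _)).trans h

lemma card_pow_four_le_add (hB : IsBStar g (S : Set ℤ)) {n : ℕ} (hS : S ⊆ Icc (1 : ℤ) n)
    (hn : 11 ≤ n) :
    64 / 75 * (#S : ℝ) ^ 4 ≤ (E[S] + (2 / 5 * g - 1) * #S ^ 2) * n + 14 / 5 * #S ^ 3 := by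
  obtain ⟨L, hL, hnL, hLn⟩ : ∃ L : ℕ, 3 ≤ L ∧ n ≤ 5 * L ∧ 5 * L ≤ n + 4 :=
    ⟨(n + 4) / 5, by omega, by omega, by omega⟩
  have hn₀ : (0 : ℝ) < n := by exact_mod_cast (by omega : 0 < n)
  have hpeak : 2 / 5 * (#S : ℝ) ^ 2 / n + #S ^ 2 / (5 * L) ≤ 7 / 5 * #S ^ 2 / n := by
    have : (#S : ℝ) ^ 2 / (5 * L) ≤ #S ^ 2 / n := by gcongr; exact_mod_cast hnL
    linarith [show 7 / 5 * (#S : ℝ) ^ 2 / n = 2 / 5 * #S ^ 2 / n + #S ^ 2 / n by ring]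
  have h := hB.sq_sub_add_pow_four_le hS hL hnL hLn
  have hexpand : 64 / 75 / n * (#S : ℝ) ^ 4
      ≤ E[S] + (2 / 5 * g - 1) * #S ^ 2 + 2 * #S * (7 / 5 * #S ^ 2 / n) := by
    nlinarith [mul_le_mul_of_nonneg_left hpeak (Nat.cast_nonneg (α := ℝ) #S),
      sq_nonneg (2 / 5 * (#S : ℝ) ^ 2 / n + #S ^ 2 / (5 * L))]
  refine sub_nonneg.1 ?_
  refine (mul_nonneg (sub_nonneg.2 hexpand) hn₀.le).trans_eq ?_
  field_simp
  ring

lemma card_sq_le_of_le_two (hB : IsBStar g (S : Set ℤ)) {n : ℕ} (hS : S ⊆ Icc (1 : ℤ) n)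
    (hg₀ : 1 ≤ g) (hg : g ≤ 2) (hn : 1 ≤ n) : (#S : ℝ) ^ 2 ≤ 1.69 * (g * n) := by
  have henergy : (E[S] : ℝ) ≤ g * #S ^ 2 := by exact_mod_cast hB.addEnergy_le
  have htest := sq_sub_add_le_addEnergy_of_const hS hn 1
  have hcard : (#S : ℝ) ≤ n := by exact_mod_cast card_le_of_subset_Icc hS
  obtain rfl | rfl : g = 1 ∨ g = 2 := by omega
  · norm_num at henergy ⊢
    nlinarith [sq_nonneg ((#S : ℝ) - 1)]
  · norm_num at henergy ⊢
    obtain hsmall | hlarge : #S ≤ 3 ∨ 4 ≤ #S := by omega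
    · have : (#S : ℝ) ≤ 3 := by exact_mod_cast hsmall
      nlinarith
    · have : (4 : ℝ) ≤ #S := by exact_mod_cast hlarge
      nlinarith

lemma card_sq_le_of_mul_le (hB : IsBStar g (S : Set ℤ)) {n : ℕ} (hS : S ⊆ Icc (1 : ℤ) n)
    (hg : 3 * n ≤ 10 * g) : (#S : ℝ) ^ 2 ≤ 1.69 * (g * n) := by
  have hg' : 3 * (n : ℝ) ≤ 10 * g := by exact_mod_cast hg
  obtain hle | hle := le_total n g
  · have hcard : (#S : ℝ) ≤ n := by exact_mod_cast card_le_of_subset_Icc hS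
    have hle' : (n : ℝ) ≤ g := by exact_mod_cast hle
    nlinarith
  · have hdensity : 2 * (#S : ℝ) ≤ n + g := by exact_mod_cast hB.two_mul_card_le hS
    have hle' : (g : ℝ) ≤ n := by exact_mod_cast hle
    nlinarith [mul_nonneg (sub_nonneg.2 hg') (sub_nonneg.2 hle'),
      pow_le_pow_left₀ (by positivity) hdensity 2]

lemma card_sq_le_of_eleven_le (hB : IsBStar g (S : Set ℤ)) {n : ℕ} (hS : S ⊆ Icc (1 : ℤ) n)
    (hn : 11 ≤ n) : (#S : ℝ) ^ 2 ≤ 1.69 * (g * n) := by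
  have henergy : (E[S] : ℝ) ≤ g * #S ^ 2 := by exact_mod_cast hB.addEnergy_le
  have hfour : 64 / 75 * (#S : ℝ) ^ 2 * #S ^ 2 ≤ 7 / 5 * (g * n) * #S ^ 2 := by
    calc 64 / 75 * (#S : ℝ) ^ 2 * (#S : ℝ) ^ 2 = 64 / 75 * (#S : ℝ) ^ 4 := by ring
      _ ≤ ((E[S] : ℝ) + 2 / 5 * g * #S ^ 2) * n := hB.card_pow_four_le hS hn
      _ ≤ (g * (#S : ℝ) ^ 2 + 2 / 5 * g * #S ^ 2) * n := by gcongr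
      _ = 7 / 5 * (g * n) * (#S : ℝ) ^ 2 := by ring
  obtain hempty | hpos := (sq_nonneg (#S : ℝ)).eq_or_lt
  · rw [← hempty]
    positivity
  · linarith [le_of_mul_le_mul_right hfour hpos, (by positivity : (0 : ℝ) ≤ g * n)]

lemma card_sq_le (hB : IsBStar g (S : Set ℤ)) {n : ℕ} (hS : S ⊆ Icc (1 : ℤ) n) (hg : 1 ≤ g)
    (hn : 1 ≤ n) : (#S : ℝ) ^ 2 ≤ 1.69 * (g * n) := by
  obtain hg₂ | hg₃ | hn₁₁ : g ≤ 2 ∨ 3 * n ≤ 10 * g ∨ 11 ≤ n := by omega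
  · exact hB.card_sq_le_of_le_two hS hg hg₂ hn
  · exact hB.card_sq_le_of_mul_le hS hg₃
  · exact hB.card_sq_le_of_eleven_le hS hn₁₁

lemma card_sub_third_sq_le_three (hB : IsBStar 3 (S : Set ℤ)) {n : ℕ} (hS : S ⊆ Icc (1 : ℤ) n)
    (hn : 1 ≤ n) : ((#S : ℝ) - 1 / 3) ^ 2 ≤ 1.7404 * (2 * n) := by
  have henergy : (E[S] : ℝ) + #S ^ 2 ≤ 3 * (#S ^ 2 + #S) := by
    exact_mod_cast hB.addEnergy_add_sq_le_of_odd (by decide)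
  have hdensity : 2 * (#S : ℝ) ≤ n + 3 := by exact_mod_cast hB.two_mul_card_le hS
  have hn' : (1 : ℝ) ≤ n := by exact_mod_cast hn
  obtain hsmall | hlarge : #S ≤ 5 ∨ 6 ≤ #S := by omega
  · have : (#S : ℝ) ≤ 5 := by exact_mod_cast hsmall
    nlinarith
  · have : (6 : ℝ) ≤ #S := by exact_mod_cast hlarge
    nlinarith [sq_sub_add_le_addEnergy_of_const hS hn (7 / 4)]

lemma card_sub_third_sq_le_five_of_twelve_le (hB : IsBStar 5 (S : Set ℤ)) {n : ℕ}
    (hS : S ⊆ Icc (1 : ℤ) n) (hcard : 12 ≤ #S) : ((#S : ℝ) - 1 / 3) ^ 2 ≤ 1.7404 * (4 * n) := by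
  have henergy : (E[S] : ℝ) + #S ^ 2 ≤ 5 * (#S ^ 2 + #S) := by
    exact_mod_cast hB.addEnergy_add_sq_le_of_odd (by decide)
  have htest := hB.sq_sub_add_le_addEnergy hS (by norm_num : 1 ≤ 6)
    ((by omega : 6 ≤ #S).trans (card_le_of_subset_Icc hS)) 3 (b := 4 / 5) (by norm_num)
  have hwindows : 3 * (#S : ℝ) ^ 2 - 103 / 5 * #S - 2422 / 5 + 576 / 5 * #S ^ 2 / (n + 5)
      ≤ 18 * n := by
    push_cast at htest
    ring_nf at htest henergy ⊢
    linarith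
  by_contra! hlt
  have hn : (n : ℝ) < (#S - 1 / 3) ^ 2 / 6.9616 := by
    rw [lt_div_iff₀ (by norm_num)]
    linarith
  have hquot : 576 / 5 * (#S : ℝ) ^ 2 / ((#S - 1 / 3) ^ 2 / 6.9616 + 5)
      ≤ 576 / 5 * #S ^ 2 / (n + 5) := by gcongr
  linarith [mul_sq_le_add_div (t := #S) (by exact_mod_cast hcard)]

lemma card_sub_third_sq_le_five (hB : IsBStar 5 (S : Set ℤ)) {n : ℕ} (hS : S ⊆ Icc (1 : ℤ) n)
    (hn : 1 ≤ n) : ((#S : ℝ) - 1 / 3) ^ 2 ≤ 1.7404 * (4 * n) := by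
  obtain hsmall | hlarge : #S ≤ 11 ∨ 12 ≤ #S := by omega
  · have hdensity : 2 * (#S : ℝ) ≤ n + 5 := by exact_mod_cast hB.two_mul_card_le hS
    have hcard : (#S : ℝ) ≤ n := by exact_mod_cast card_le_of_subset_Icc hS
    have hsmall' : (#S : ℝ) ≤ 11 := by exact_mod_cast hsmall
    have hn' : (1 : ℝ) ≤ n := by exact_mod_cast hn
    obtain h | h := le_total (#S : ℝ) 5
    · nlinarith
    · nlinarith
  · exact hB.card_sub_third_sq_le_five_of_twelve_le hS hlarge

lemma card_sub_third_sq_le_of_seven_le_of_eleven_le (hB : IsBStar g (S : Set ℤ)) (hodd : Odd g)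
    (hg : 7 ≤ g) {n : ℕ} (hS : S ⊆ Icc (1 : ℤ) n) (hcard : 11 ≤ #S) :
    ((#S : ℝ) - 1 / 3) ^ 2 ≤ 1.7404 * ((g - 1) * n) := by
  have henergy : (E[S] : ℝ) + #S ^ 2 ≤ g * (#S ^ 2 + #S) := by
    exact_mod_cast hB.addEnergy_add_sq_le_of_odd hodd
  have hN : (11 : ℝ) ≤ #S := by exact_mod_cast hcard
  have hg' : (7 : ℝ) ≤ g := by exact_mod_cast hg
  have hcubic : 64 / 75 * (#S : ℝ) ^ 3 ≤ ((7 / 5 * g - 1) * #S + g) * n := by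
    refine le_of_mul_le_mul_right ?_ (by positivity : (0 : ℝ) < #S)
    have hfour := hB.card_pow_four_le hS (hcard.trans (card_le_of_subset_Icc hS))
    nlinarith [mul_le_mul_of_nonneg_right henergy (Nat.cast_nonneg (α := ℝ) n)]
  have hcoeff : (0 : ℝ) < (7 / 5 * g - 1) * #S + g := by nlinarith
  refine le_of_mul_le_mul_left ?_ hcoeff
  calc ((7 / 5 * g - 1) * #S + g) * ((#S : ℝ) - 1 / 3) ^ 2
      ≤ 1.7404 * (g - 1) * (64 / 75 * (#S : ℝ) ^ 3) := mul_sub_third_sq_le hg' hN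
    _ ≤ 1.7404 * (g - 1) * (((7 / 5 * g - 1) * (#S : ℝ) + g) * n) := by
      gcongr
      linarith
    _ = ((7 / 5 * g - 1) * (#S : ℝ) + g) * (1.7404 * ((g - 1) * n)) := by ring

lemma card_sub_third_sq_le_of_seven_le (hB : IsBStar g (S : Set ℤ)) (hodd : Odd g) (hg : 7 ≤ g)
    {n : ℕ} (hS : S ⊆ Icc (1 : ℤ) n) (hn : 1 ≤ n) :
    ((#S : ℝ) - 1 / 3) ^ 2 ≤ 1.7404 * ((g - 1) * n) := by
  obtain hsmall | hlarge : #S ≤ 10 ∨ 11 ≤ #S := by omega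
  · have hcard : (#S : ℝ) ≤ n := by exact_mod_cast card_le_of_subset_Icc hS
    have hn' : (1 : ℝ) ≤ n := by exact_mod_cast hn
    have hsmall' : (#S : ℝ) ≤ 10 := by exact_mod_cast hsmall
    have hg' : 6 * (n : ℝ) ≤ (g - 1) * n := by
      gcongr
      linarith [show (7 : ℝ) ≤ g by exact_mod_cast hg]
    nlinarith
  · exact hB.card_sub_third_sq_le_of_seven_le_of_eleven_le hodd hg hS hlarge

lemma card_sub_third_sq_le (hB : IsBStar g (S : Set ℤ)) (hodd : Odd g) (hg : 3 ≤ g) {n : ℕ}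
    (hS : S ⊆ Icc (1 : ℤ) n) (hn : 1 ≤ n) :
    ((#S : ℝ) - 1 / 3) ^ 2 ≤ 1.7404 * ((g - 1) * n) := by
  obtain rfl | rfl | hg₇ : g = 3 ∨ g = 5 ∨ 7 ≤ g := by
    obtain ⟨k, rfl⟩ := hodd
    omega
  · convert hB.card_sub_third_sq_le_three hS hn
    norm_num
  · convert hB.card_sub_third_sq_le_five hS hn
    norm_num
  · exact hB.card_sub_third_sq_le_of_seven_le hodd hg₇ hS hn

end IsBStar

/-! ### Bounds for `R` and its upper limit -/

lemma exists_card_eq_R (g n : ℕ) :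
    ∃ S : Finset ℤ, S ⊆ Icc (1 : ℤ) n ∧ IsBStar g (S : Set ℤ) ∧ #S = R g n := by
  classical
  obtain ⟨S, hS, hR⟩ := exists_mem_eq_sup
    ((Icc (1 : ℤ) n).powerset.filter fun S : Finset ℤ => IsBStar g (S : Set ℤ))
    ⟨∅, by simp [IsBStar]⟩ card
  rw [mem_filter, mem_powerset] at hS
  exact ⟨S, hS.1, hS.2, by rw [← hR, R]⟩

lemma R_le_mul_sqrt {g n : ℕ} (hg : 1 ≤ g) (hn : 1 ≤ n) : (R g n : ℝ) ≤ 1.3 * √(g * n) := by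
  obtain ⟨S, hS, hB, hR⟩ := exists_card_eq_R g n
  refine le_of_sq_le_sq ?_ (by positivity)
  rw [← hR, mul_pow, Real.sq_sqrt (by positivity)]
  norm_num1
  linarith [hB.card_sq_le hS hg hn]

lemma R_le_mul_sqrt_add_third {g n : ℕ} (hg : 3 ≤ g) (hodd : Odd g) (hn : 1 ≤ n) :
    (R g n : ℝ) ≤ 1.31925 * √((g - 1) * n) + 1 / 3 := by
  obtain ⟨S, hS, hB, hR⟩ := exists_card_eq_R g n
  have hgn : (0 : ℝ) ≤ (g - 1) * n :=
    mul_nonneg (sub_nonneg.2 (by exact_mod_cast (by omega : 1 ≤ g))) (Nat.cast_nonneg n)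
  rw [← hR, ← sub_le_iff_le_add]
  refine le_of_sq_le_sq ?_ (by positivity)
  rw [mul_pow, Real.sq_sqrt hgn]
  linarith [hB.card_sub_third_sq_le hodd hg hS hn]

lemma rhoBar_mem_Icc_of_tendsto {g : ℕ} {u : ℕ → ℝ} {c : ℝ} (hu : Tendsto u atTop (𝓝 c))
    (hle : ∀ᶠ n : ℕ in atTop, R g n / √((g : ℝ) * n) ≤ u n) : rhoBar g ∈ Set.Icc 0 c := by
  have hnonneg (n : ℕ) : 0 ≤ R g n / √((g : ℝ) * n) := by positivity
  constructor
  · exact le_limsup_of_frequently_le (Frequently.of_forall hnonneg)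
      (hu.isBoundedUnder_le.mono_le hle)
  · rw [← hu.limsup_eq]
    exact limsup_le_limsup hle (isCoboundedUnder_le_of_le atTop hnonneg) hu.isBoundedUnder_le

lemma rhoBar_sq_le_of_sq_le {g : ℕ} (hg : 1 ≤ g) {A C : ℝ} (hA : 0 ≤ A) (hC : 0 ≤ C)
    (h : ∀ᶠ n : ℕ in atTop, (R g n : ℝ) ^ 2 ≤ A * n + C * R g n) : rhoBar g ^ 2 ≤ A / g := by
  have hg₀ : (0 : ℝ) < g := by exact_mod_cast hg
  have hsqrt : Tendsto (fun n : ℕ => √((g : ℝ) * n)) atTop atTop :=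
    Real.tendsto_sqrt_atTop.comp (tendsto_natCast_atTop_atTop.const_mul_atTop hg₀)
  have hlim : Tendsto (fun n : ℕ => √(A / g) + C / √((g : ℝ) * n)) atTop (𝓝 √(A / g)) := by
    simpa using tendsto_const_nhds.add (hsqrt.const_div_atTop C)
  have hle : ∀ᶠ n : ℕ in atTop, R g n / √((g : ℝ) * n) ≤ √(A / g) + C / √((g : ℝ) * n) := by
    filter_upwards [h, hsqrt.eventually_gt_atTop 0] with n hn hpos
    have hscale : √(A / g) * √((g : ℝ) * n) = √(A * n) := by
      rw [← Real.sqrt_mul (by positivity), ← mul_assoc, div_mul_cancel₀ _ hg₀.ne']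
    rw [div_le_iff₀ hpos, add_mul, div_mul_cancel₀ _ hpos.ne', hscale, ← sub_le_iff_le_add]
    obtain hR | hR := le_total (R g n : ℝ) C
    · exact (sub_nonpos.2 hR).trans (Real.sqrt_nonneg _)
    · exact Real.le_sqrt_of_sq_le (by nlinarith)
  obtain ⟨hnonneg, hupper⟩ := rhoBar_mem_Icc_of_tendsto hlim hle
  exact (Real.le_sqrt hnonneg (by positivity)).1 hupper

lemma sq_le_of_pow_four_le {N x A B C : ℝ} (hN : 0 ≤ N) (hx : 0 ≤ x) (hA : 0 < A) (hB : 0 ≤ B)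
    (hC : 0 ≤ C) (h : N ^ 4 ≤ (A * N ^ 2 + B * N) * x + C * N ^ 3) :
    N ^ 2 ≤ A * x + (B / A + C) * N := by
  obtain hsmall | hlarge := le_total (N ^ 2) (A * x)
  · exact hsmall.trans (le_add_of_nonneg_right (by positivity))
  obtain rfl | hpos := hN.eq_or_lt
  · simpa using mul_nonneg hA.le hx
  refine le_of_mul_le_mul_right ?_ (pow_pos hpos 2)
  calc N ^ 2 * N ^ 2 = N ^ 4 := by ring
    _ ≤ (A * N ^ 2 + B * N) * x + C * N ^ 3 := h
    _ = A * x * N ^ 2 + B / A * N * (A * x) + C * N ^ 3 := by field_simp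
    _ ≤ A * x * N ^ 2 + B / A * N * N ^ 2 + C * N ^ 3 := by gcongr
    _ = (A * x + (B / A + C) * N) * N ^ 2 := by ring

lemma rhoBar_sq_le_of_pow_four_le {g : ℕ} (hg : 1 ≤ g) {A B C : ℝ} (hA : 0 < A) (hB : 0 ≤ B)
    (hC : 0 ≤ C)
    (h : ∀ᶠ n : ℕ in atTop, ∀ S ⊆ Icc (1 : ℤ) n, IsBStar g (S : Set ℤ) →
      (#S : ℝ) ^ 4 ≤ (A * #S ^ 2 + B * #S) * n + C * #S ^ 3) :
    rhoBar g ^ 2 ≤ A / g := by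
  refine rhoBar_sq_le_of_sq_le (C := B / A + C) hg hA.le (by positivity) ?_
  filter_upwards [h] with n hn
  obtain ⟨S, hS, hBStar, hR⟩ := exists_card_eq_R g n
  rw [← hR]
  exact sq_le_of_pow_four_le (Nat.cast_nonneg _) (Nat.cast_nonneg n) hA hB hC (hn S hS hBStar)

lemma rhoBar_sq_le {g : ℕ} (hg : 1 ≤ g) : rhoBar g ^ 2 ≤ 105 / 64 - 75 / 64 / g := by
  have hg' : (1 : ℝ) ≤ g := by exact_mod_cast hg
  have hbound := rhoBar_sq_le_of_pow_four_le hg (A := 105 / 64 * g - 75 / 64) (B := 0)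
    (C := 105 / 32) (by linarith) le_rfl (by norm_num) <| by
      filter_upwards [eventually_ge_atTop 11] with n hn S hS hB
      have henergy : (E[S] : ℝ) ≤ g * #S ^ 2 := by exact_mod_cast hB.addEnergy_le
      linarith [hB.card_pow_four_le_add hS hn,
        mul_le_mul_of_nonneg_right henergy (Nat.cast_nonneg (α := ℝ) n)]
  rwa [sub_div, mul_div_cancel_right₀ _ (by positivity)] at hbound

lemma rhoBar_sq_le_of_odd {g : ℕ} (hg : 3 ≤ g) (hodd : Odd g) :
    rhoBar g ^ 2 ≤ 105 / 64 - 75 / 32 / g := by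
  have hg' : (3 : ℝ) ≤ g := by exact_mod_cast hg
  have hbound := rhoBar_sq_le_of_pow_four_le (by omega : 1 ≤ g) (A := 105 / 64 * g - 75 / 32)
    (B := 75 / 64 * g) (C := 105 / 32) (by linarith) (by positivity) (by norm_num) <| by
      filter_upwards [eventually_ge_atTop 11] with n hn S hS hB
      have henergy : (E[S] : ℝ) + #S ^ 2 ≤ g * (#S ^ 2 + #S) := by
        exact_mod_cast hB.addEnergy_add_sq_le_of_odd hodd
      linarith [hB.card_pow_four_le_add hS hn,
        mul_le_mul_of_nonneg_right henergy (Nat.cast_nonneg (α := ℝ) n)]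
  rwa [sub_div, mul_div_cancel_right₀ _ (by positivity)] at hbound

lemma card_pow_four_le_of_const {S : Finset ℤ} {n : ℕ} (hS : S ⊆ Icc (1 : ℤ) n) (hn : 1 ≤ n) :
    (#S : ℝ) ^ 4 ≤ 2 * (E[S] - #S ^ 2) * n + 2 * #S ^ 3 := by
  have : (0 : ℝ) < n := by exact_mod_cast hn
  set a : ℝ := #S ^ 2 / (2 * n) with ha
  have htest : (#S : ℝ) ^ 2 - 2 * a * #S + 2 * a * #S ^ 2 ≤ E[S] + 2 * n * a ^ 2 := by
    linarith [sq_sub_add_le_addEnergy_of_const hS hn a, sq_nonneg a]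
  refine sub_nonneg.1 ?_
  refine (mul_nonneg (sub_nonneg.2 htest) (by positivity : (0 : ℝ) ≤ 2 * n)).trans_eq ?_
  rw [ha]
  field_simp
  ring

lemma rhoBar_sq_le_two_sub_of_odd {g : ℕ} (hg : 3 ≤ g) (hodd : Odd g) :
    rhoBar g ^ 2 ≤ 2 - 4 / g := by
  have hg' : (3 : ℝ) ≤ g := by exact_mod_cast hg
  have hbound := rhoBar_sq_le_of_pow_four_le (by omega : 1 ≤ g) (A := 2 * g - 4)
    (B := 2 * g) (C := 2) (by linarith) (by positivity) (by norm_num) <| by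
      filter_upwards [eventually_ge_atTop 1] with n hn S hS hB
      have henergy : (E[S] : ℝ) + #S ^ 2 ≤ g * (#S ^ 2 + #S) := by
        exact_mod_cast hB.addEnergy_add_sq_le_of_odd hodd
      linarith [card_pow_four_le_of_const hS hn,
        mul_le_mul_of_nonneg_right henergy (Nat.cast_nonneg (α := ℝ) n)]
  rwa [sub_div, mul_div_cancel_right₀ _ (by positivity)] at hbound

lemma sub_inv_le_add_sqrt_of_even {x : ℝ} (hx : 0 ≤ x) :
    105 / 64 - 75 / 64 / x
      ≤ 1.58337 - 0.026335 / x + √(0.011572 - 0.083397 / x + 0.00069356 / x ^ 2) := by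
  simp only [div_eq_mul_inv _ x, div_eq_mul_inv _ (x ^ 2), ← inv_pow]
  have hy : 0 ≤ x⁻¹ := inv_nonneg.2 hx
  generalize x⁻¹ = y at hy
  rw [← sub_le_iff_le_add']
  obtain hsmall | hlarge := le_total y (1 / 20)
  · exact Real.le_sqrt_of_sq_le (by nlinarith)
  · exact le_trans (by linarith) (Real.sqrt_nonneg _)

lemma sub_inv_le_add_sqrt_of_odd {x : ℝ} (hx : 0 ≤ x) :
    105 / 64 - 75 / 32 / x
      ≤ 1.58337 - 0.071949 / x + √(0.011572 - 0.22784 / x + 0.0051768 / x ^ 2) := by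
  simp only [div_eq_mul_inv _ x, div_eq_mul_inv _ (x ^ 2), ← inv_pow]
  have hy : 0 ≤ x⁻¹ := inv_nonneg.2 hx
  generalize x⁻¹ = y at hy
  rw [← sub_le_iff_le_add']
  obtain hsmall | hlarge := le_total y (1 / 35)
  · exact Real.le_sqrt_of_sq_le (by nlinarith)
  · exact le_trans (by linarith) (Real.sqrt_nonneg _)

lemma sub_inv_le_of_even {x : ℝ} (hx : 0 ≤ x) :
    105 / 64 - 75 / 64 / x ≤ 1.74043 - 1.00483 / x := by
  simp only [div_eq_mul_inv _ x]
  linarith [inv_nonneg.2 hx]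

lemma min_sub_inv_le_of_odd (x : ℝ) :
    min (2 - 4 / x) (105 / 64 - 75 / 32 / x) ≤ 1.74043 - 2.74525 / x := by
  simp only [div_eq_mul_inv _ x, min_le_iff]
  by_contra! h
  linarith [h.1, h.2]

end BStar

theorem theorem2_general :
    (∀ g n : ℕ, 1 ≤ g → 1 ≤ n → (BStar.R g n : ℝ) ≤ 1.3 * √((g : ℝ) * n)) ∧
    (∀ g n : ℕ, 3 ≤ g → Odd g → 1 ≤ n →
      (BStar.R g n : ℝ) ≤ 1.31925 * √(((g : ℝ) - 1) * n) + 1 / 3) ∧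
    (∀ g : ℕ, 1 ≤ g → BStar.rhoBar g ^ 2 ≤ 105 / 64 - 75 / 64 / g) ∧
    (∀ g : ℕ, 3 ≤ g → Odd g →
      BStar.rhoBar g ^ 2 ≤ min (2 - 4 / (g : ℝ)) (105 / 64 - 75 / 32 / g)) :=
  ⟨fun _ _ => BStar.R_le_mul_sqrt, fun _ _ => BStar.R_le_mul_sqrt_add_third,
    fun _ => BStar.rhoBar_sq_le, fun _ hg hodd =>
      le_min (BStar.rhoBar_sq_le_two_sub_of_odd hg hodd) (BStar.rhoBar_sq_le_of_odd hg hodd)⟩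

theorem theorem2 :
    (∀ g n : ℕ, 1 ≤ g → 1 ≤ n →
      (BStar.R g n : ℝ) ≤ 1.30036 * √((g : ℝ) * (n : ℝ))) ∧
    (∀ g n : ℕ, 2 ≤ g → Odd g → 1 ≤ n →
      (BStar.R g n : ℝ) ≤ 1.31925 * √(((g : ℝ) - 1) * (n : ℝ)) + 1 / 3) ∧
    (∀ g : ℕ, 2 ≤ g → g ≤ 8 → Even g →
      BStar.rhoBar g ^ 2 ≤ 1.74043 - 1.00483 / (g : ℝ)) ∧
    (∀ g : ℕ, 10 ≤ g → Even g →
      BStar.rhoBar g ^ 2 ≤ 1.58337 - 0.026335 / (g : ℝ)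
        + √(0.011572 - 0.083397 / (g : ℝ) + 0.00069356 / (g : ℝ) ^ 2)) ∧
    (∀ g : ℕ, 2 ≤ g → g ≤ 23 → Odd g →
      BStar.rhoBar g ^ 2 ≤ 1.74043 - 2.74525 / (g : ℝ)) ∧
    (∀ g : ℕ, 25 ≤ g → Odd g →
      BStar.rhoBar g ^ 2 ≤ 1.58337 - 0.071949 / (g : ℝ)
        + √(0.011572 - 0.22784 / (g : ℝ) + 0.0051768 / (g : ℝ) ^ 2)) := by
  obtain ⟨hR, hRodd, hrho, hrhoOdd⟩ := theorem2_general
  have three_le (g : ℕ) (hg : 2 ≤ g) (hodd : Odd g) : 3 ≤ g := by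
    obtain ⟨k, rfl⟩ := hodd
    omega
  refine ⟨fun g n hg hn => (hR g n hg hn).trans (by gcongr; norm_num),
    fun g n hg hodd hn => hRodd g n (three_le g hg hodd) hodd hn,
    fun g hg _ _ => (hrho g (by omega)).trans (BStar.sub_inv_le_of_even g.cast_nonneg),
    fun g hg _ => (hrho g (by omega)).trans (BStar.sub_inv_le_add_sqrt_of_even g.cast_nonneg),
    fun g hg _ hodd => (hrhoOdd g (three_le g hg hodd) hodd).trans (BStar.min_sub_inv_le_of_odd g),
    fun g hg hodd => (hrhoOdd g (by omega) hodd).trans <|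
      (min_le_right _ _).trans (BStar.sub_inv_le_add_sqrt_of_odd g.cast_nonneg)⟩
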